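/- Let $0<\lambda<1$, let $d\ge 0$ be an integer, and put $$S=\left\lfloor d^2\,\frac{(\lambda/100)^4}{4\log_2(100/\lambda)}\right\rfloor .$$ Then there exists on $\mathcal B(\mathbb C^d)$ a quantum-ID code of error $\lambda$ (with blind encoder and ID-visible decoder) whose message space is $\mathcal M=\mathbb C^S$. That is, there are a completely positive, trace preserving linear map $\varepsilon:\mathcal B(\mathbb C^S)\to\mathcal B(\mathbb C^d)$ and a map $\tau\mapsto D_\tau\in\mathcal B(\mathbb C^d)$, defined on the pure states $\tau=|\theta\rangle\langle\theta|$ of $\mathbb C^S$ and with $0\le D_\tau\le \mathbb 1$, such that for all pure states $\pi,\tau$ on $\mathbb C^S$ $$\bigl|\operatorname{Tr}(\pi\tau)-\operatorname{Tr}\bigl(\varepsilon(\pi)D_\tau\bigr)\bigr|\le\frac{\lambda}{2}.$$ Moreover, the code can be chosen such that the encoder is an isometry followed by a partial trace, i.e. $\varepsilon(X)=\operatorname{Tr}_{\mathbb C^a}(VXV^*)$ for some integer $a\ge 0$ and some isometry $V:\mathbb C^S\to\mathbb C^d\otimes\mathbb C^a$, and such that the decoders are support projectors: for every pure state $\tau$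 there is a pure state $\tau'$ on $\mathbb C^S$ such that $D_\tau$ is the orthogonal projector onto the range of $\varepsilon(\tau')$. -/

import Mathlib

open scoped ComplexOrder MatrixOrder Matrix.Norms.L2Operator CStarAlgebra Matrix

namespace QuantumID

/-- The pure states `|φ⟩⟨φ|`, `φ` a unit vector, on the Hilbert space `ℂ^ι`. -/
def PureState (ι : Type*) [Fintype ι] : Type _ :=
  {ρ : Matrix ι ι ℂ // ∃ φ : EuclideanSpace ℂ ι, ‖φ‖ = 1 ∧ ρ = Matrix.vecMulVec ⇑φ (star ⇑φ)}

/-- The density matrix of a pure state. -/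
def PureState.density {ι : Type*} [Fintype ι] (τ : PureState ι) : Matrix ι ι ℂ := τ.1

/-- A quantum channel from `B(ℂ^ι)` to `B(ℂ^κ)`: a completely positive, trace preserving
linear map. -/
structure Channel (ι κ : Type*) [Fintype ι] [DecidableEq ι] [Fintype κ] [DecidableEq κ] where
  toCP : Matrix ι ι ℂ →CP Matrix κ κ ℂ
  trace_map : ∀ X, (toCP X).trace = X.trace

/-- The partial trace over the second tensor factor, from `B(ℂ^ι ⊗ ℂ^κ)` to `B(ℂ^ι)`. -/
def partialTraceRight {ι κ : Type*} [Fintype κ] (X : Matrix (ι × κ) (ι × κ) ℂ) :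
    Matrix ι ι ℂ :=
  Matrix.of fun i j => ∑ k, X (i, k) (j, k)

/-- `P` is the support projector of the self-adjoint matrix `ρ`: the orthogonal projector onto the
range of `ρ`. -/
def IsSupportProjector {ι : Type*} [Fintype ι] (P ρ : Matrix ι ι ℂ) : Prop :=
  IsStarProjection P ∧ LinearMap.range P.mulVecLin = LinearMap.range ρ.mulVecLin

/-- A quantum-ID code of error `lam` on `B(ℂ^κ)`, with message space `ℂ^ι`. The encoder is a
channel (blind encoder); the decoder assigns to each pure state `τ` the test `(D τ, 1 - D τ)`
(ID-visible decoder). The order on matrices is the Loewner order. -/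
structure QuantumIDCode (ι κ : Type*) [Fintype ι] [DecidableEq ι] [Fintype κ] [DecidableEq κ]
    (lam : ℝ) where
  encoder : Channel ι κ
  decoder : PureState ι → Matrix κ κ ℂ
  decoder_nonneg : ∀ τ, 0 ≤ decoder τ
  decoder_le_one : ∀ τ, decoder τ ≤ 1
  error_le : ∀ π τ : PureState ι,
    ‖(π.density * τ.density).trace - (encoder.toCP π.density * decoder τ).trace‖ ≤ lam / 2

end QuantumID

/-!
The encoder is built from a random subspace of `ℂ^d ⊗ ℂ^a`, where `a` is about `lam * d / 300`.

*The test.* Let `V` be an isometry from `ℂ^S` to `ℂ^d ⊗ ℂ^a`, let `x = V θ'` be a code vector, and let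
`D` be the support projector of its reduced state. In matrix form (`toMat`) the operator `D ⊗ 1` is
the orthogonal projector onto the vectors with matrix `toMat x * T`, where `T` is any `a × a` matrix
(`starProjection_range_columnAction`). This range contains `x` and has dimension at most `a ^ 2`. As
`D ⊗ 1` fixes `x`, the probability of accepting `V φ` is `|⟨θ', φ⟩|²` plus the squared norm of
`(D ⊗ 1) V ψ`, where `ψ` is the component of `φ` orthogonal to `θ'`. It therefore suffices that the
latter is at most `lam / 4`, for messages `θ'` that approximate every `θ` up to `lam / 8`
(`abs_overlap_sub_le`). Restricting to a net of messages `θ'` is essential, since the support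
projector does not depend continuously on the state.

*Randomness.* Take a linear map `G` from `ℂ^S` to `ℂ^d ⊗ ℂ^a` with independent standard Gaussian
columns, and a net `T` of the unit sphere of mesh `lam / 200`. For orthonormal `n` and `u` the vectors
`G n` and `G u` are independent (`map_evalColumns_prodMk`), so conditionally on `G n` the vector `G u`
is projected to a fixed subspace of dimension at most `a ^ 2` in a space of dimension `d * a`, and a
Chernoff bound makes a large projection unlikely (`stdGaussian_prod_exists_range_le`). Similar bounds
control `‖G n‖` from both sides. The size of `S` is such that the union bound over `T` and over pairs
in `T` leaves a positive probability (`exists_parameter_bound`, `union_bound_lt_one`,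
`exists_mapOfColumns`).

*The isometry.* The estimates on the net extend to all vectors, so that `G` is well conditioned, and
any isometry `V` with the same range as `G` inherits the projection estimate, because a multiple of
`x` can be added to a vector at no cost (`norm_starProjection_le_of_inner_eq_zero`,
`exists_linearIsometry_of_net`).
-/

open scoped ComplexOrder MatrixOrder Matrix.Norms.L2Operator CStarAlgebra Matrix

namespace QuantumID


/-! ### Standard Gaussian vectors -/

section Gaussian
open MeasureTheory ProbabilityTheory
open scoped RealInnerProductSpace

variable {E F F' : Type*}
  [NormedAddCommGroup E] [InnerProductSpace ℝ E] [FiniteDimensional ℝ E]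
  [MeasurableSpace E] [BorelSpace E]
  [NormedAddCommGroup F] [InnerProductSpace ℝ F] [FiniteDimensional ℝ F]
  [MeasurableSpace F] [BorelSpace F]
  [NormedAddCommGroup F'] [InnerProductSpace ℝ F'] [FiniteDimensional ℝ F']
  [MeasurableSpace F'] [BorelSpace F']

/-- A linear map whose adjoint `T'` is isometric carries the standard Gaussian measure to the
standard Gaussian measure: compare characteristic functions. -/
theorem stdGaussian_map_of_coisometry (T : E →L[ℝ] F) (T' : F → E)
    (hadj : ∀ x y, ⟪T x, y⟫ = ⟪x, T' y⟫) (hnorm : ∀ y, ‖T' y‖ = ‖y‖) :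
    (stdGaussian E).map T = stdGaussian F := by
  apply Measure.ext_of_charFun
  ext y
  rw [charFun_stdGaussian, charFun_apply, integral_map (by fun_prop) (by fun_prop)]
  simp_rw [hadj]
  rw [← charFun_apply, charFun_stdGaussian, hnorm]

/-- If the adjoints of `T₁` and `T₂` are isometric with orthogonal ranges, then `T₁ x` and `T₂ x` are
independent standard Gaussian vectors when `x` is one. -/
theorem stdGaussian_map_prodMk (T₁ : E →L[ℝ] F) (T₂ : E →L[ℝ] F') (T₁' : F → E) (T₂' : F' → E)
    (hadj₁ : ∀ x y, ⟪T₁ x, y⟫ = ⟪x, T₁' y⟫) (hadj₂ : ∀ x y, ⟪T₂ x, y⟫ = ⟪x, T₂' y⟫)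
    (hnorm : ∀ y₁ y₂, ‖T₁' y₁ + T₂' y₂‖ ^ 2 = ‖y₁‖ ^ 2 + ‖y₂‖ ^ 2) :
    (stdGaussian E).map (fun x => (T₁ x, T₂ x)) = (stdGaussian F).prod (stdGaussian F') := by
  have hm : Measurable fun x => (T₁ x, T₂ x) := by fun_prop
  have := Measure.isProbabilityMeasure_map (μ := stdGaussian E) hm.aemeasurable
  rw [← charFun_eq_prod_iff]
  intro t
  rw [Measure.map_map (by fun_prop) hm, charFun_apply, integral_map (by fun_prop) (by fun_prop)]
  have : ∀ x, ⟪((WithLp.toLp 2) ∘ fun x => (T₁ x, T₂ x)) x, t⟫ =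
      ⟪x, T₁' (WithLp.ofLp t).1 + T₂' (WithLp.ofLp t).2⟫ := fun x => by
    rw [WithLp.prod_inner_apply, inner_add_right, ← hadj₁, ← hadj₂]; rfl
  simp_rw [this]
  rw [← charFun_apply, charFun_stdGaussian, charFun_stdGaussian, charFun_stdGaussian,
    ← Complex.exp_add]
  congr 1
  have := hnorm (WithLp.ofLp t).1 (WithLp.ofLp t).2
  have h2 := congrArg (fun r : ℝ => (r : ℂ)) this
  push_cast at h2
  rw [h2]; ring

theorem integrable_exp_mul_sq_gaussianReal {s : ℝ} (hs : s < 1 / 2) :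
    Integrable (fun x => Real.exp (s * x ^ 2)) (gaussianReal 0 1) := by
  rw [gaussianReal, if_neg one_ne_zero, integrable_withDensity_iff_integrable_smul'
    (measurable_gaussianPDF _ _) (by simp [gaussianPDF])]
  have : Integrable fun x : ℝ => (√(2 * Real.pi))⁻¹ * Real.exp (-(1 / 2 - s) * x ^ 2) :=
    (integrable_exp_neg_mul_sq (by linarith)).const_mul _
  refine this.congr (Filter.Eventually.of_forall fun x => ?_)
  simp only [toReal_gaussianPDF, gaussianPDFReal, smul_eq_mul]
  rw [mul_assoc, ← Real.exp_add]
  simp only [NNReal.coe_one, mul_one, sub_zero]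
  congr 2
  ring

theorem integral_exp_mul_sq_gaussianReal {s : ℝ} (hs : s < 1 / 2) :
    ∫ x, Real.exp (s * x ^ 2) ∂(gaussianReal 0 1) = (√(1 - 2 * s))⁻¹ := by
  rw [integral_gaussianReal_eq_integral_smul one_ne_zero]
  have : ∀ x : ℝ, gaussianPDFReal 0 1 x • Real.exp (s * x ^ 2) =
      (√(2 * Real.pi))⁻¹ * Real.exp (-(1 / 2 - s) * x ^ 2) := fun x => by
    simp only [gaussianPDFReal, smul_eq_mul]
    rw [mul_assoc, ← Real.exp_add]
    simp only [NNReal.coe_one, mul_one, sub_zero]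
    congr 2
    ring
  simp_rw [this]
  rw [integral_const_mul, integral_gaussian, ← Real.sqrt_inv, ← Real.sqrt_inv, ← Real.sqrt_mul (by positivity)]
  congr 1
  have : (1 / 2 - s) ≠ 0 := by linarith
  have : (1 - 2 * s) ≠ 0 := by linarith
  have := Real.pi_ne_zero
  field_simp

theorem integrable_exp_mul_normSq_stdGaussian {s : ℝ} (hs : s < 1 / 2) :
    Integrable (fun x : E => Real.exp (s * ‖x‖ ^ 2)) (stdGaussian E) := by
  rw [stdGaussian, integrable_map_measure (by fun_prop) (Measurable.aemeasurable (by fun_prop))]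
  have : ((fun x : E => Real.exp (s * ‖x‖ ^ 2)) ∘ fun x : Fin (Module.finrank ℝ E) → ℝ =>
      ∑ i, x i • stdOrthonormalBasis ℝ E i) = fun x => ∏ i, Real.exp (s * x i ^ 2) := by
    ext x
    rw [← Real.exp_sum, ← Finset.mul_sum, Function.comp_apply,
      ← (stdOrthonormalBasis ℝ E).sum_sq_inner_right]
    simp [(stdOrthonormalBasis ℝ E).orthonormal.inner_right_fintype]
  rw [this]
  exact Integrable.fintype_prod fun i => integrable_exp_mul_sq_gaussianReal hs

theorem mgf_normSq_stdGaussian {s : ℝ} (hs : s < 1 / 2) :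
    mgf (fun x : E => ‖x‖ ^ 2) (stdGaussian E) s = (√(1 - 2 * s))⁻¹ ^ Module.finrank ℝ E := by
  rw [mgf, stdGaussian, integral_map (Measurable.aemeasurable (by fun_prop)) (by fun_prop)]
  have : ∀ x : Fin (Module.finrank ℝ E) → ℝ,
      Real.exp (s * ‖∑ i, x i • stdOrthonormalBasis ℝ E i‖ ^ 2) =
        ∏ i, Real.exp (s * x i ^ 2) := by
    intro x
    rw [← Real.exp_sum, ← Finset.mul_sum, ← (stdOrthonormalBasis ℝ E).sum_sq_inner_right]
    simp [(stdOrthonormalBasis ℝ E).orthonormal.inner_right_fintype]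
  simp_rw [this]
  rw [integral_fintype_prod_eq_pow (f := fun x : ℝ => Real.exp (s * x ^ 2)),
    integral_exp_mul_sq_gaussianReal hs, Fintype.card_fin]

/-- Chernoff bound with exponent `1 / 4`, for which the moment generating function is
`√2 ^ dim E`. -/
theorem stdGaussian_normSq_ge_le (t : ℝ) :
    (stdGaussian E).real {x | t ≤ ‖x‖ ^ 2} ≤ Real.exp (-t / 4) * √2 ^ Module.finrank ℝ E := by
  have := measure_ge_le_exp_mul_mgf (μ := stdGaussian E) (X := fun x : E => ‖x‖ ^ 2) t
    (t := 1 / 4) (by norm_num) (integrable_exp_mul_normSq_stdGaussian (by norm_num))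
  rw [mgf_normSq_stdGaussian (by norm_num)] at this
  convert this using 2
  · congr 1; ring
  · rw [← Real.sqrt_inv]; norm_num

/-- Chernoff bound with exponent `-3 / 2`, for which the moment generating function is
`(1 / 2) ^ dim E`. -/
theorem stdGaussian_normSq_le_le (t : ℝ) :
    (stdGaussian E).real {x | ‖x‖ ^ 2 ≤ t} ≤
      Real.exp (3 / 2 * t) * (1 / 2) ^ Module.finrank ℝ E := by
  have := measure_le_le_exp_mul_mgf (μ := stdGaussian E) (X := fun x : E => ‖x‖ ^ 2) t
    (t := -(3 / 2)) (by norm_num) (integrable_exp_mul_normSq_stdGaussian (by norm_num))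
  rw [mgf_normSq_stdGaussian (by norm_num)] at this
  convert this using 2
  · congr 1; ring
  · rw [show (1 - 2 * (-(3 / 2)) : ℝ) = 2 ^ 2 by norm_num, Real.sqrt_sq (by norm_num)]
    norm_num

/-- The projection of a standard Gaussian vector to a subspace `K` is standard Gaussian in `K`. -/
theorem stdGaussian_normSq_starProjection_ge_le (K : Submodule ℝ E) (t : ℝ) :
    (stdGaussian E).real {x | t ≤ ‖K.starProjection x‖ ^ 2} ≤
      Real.exp (-t / 4) * √2 ^ Module.finrank ℝ K := by
  have h := stdGaussian_map_of_coisometry (E := E) (F := K) K.orthogonalProjectionOnto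
    (fun y => (y : E)) (fun x y => by simp) (fun y => rfl)
  have h2 := stdGaussian_normSq_ge_le (E := K) t
  rw [← h, map_measureReal_apply (by fun_prop) (measurableSet_le (by fun_prop) (by fun_prop))] at h2
  exact h2

end Gaussian

/-! ### Nets of the unit sphere -/

section Net
open MeasureTheory Metric Module

variable {E : Type*} [NormedAddCommGroup E] [NormedSpace ℝ E] [FiniteDimensional ℝ E]

/-- Volume bound: the balls of radius `ε / 2` about the points are disjoint and lie in the ball of
radius `1 + ε / 2`. -/
theorem card_le_of_separated_of_norm_le_one {ε : ℝ} (hε : 0 < ε) (s : Finset E)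
    (hs : ∀ c ∈ s, ‖c‖ ≤ 1) (h : ∀ c ∈ s, ∀ d ∈ s, c ≠ d → ε ≤ ‖c - d‖) :
    (s.card : ℝ) ≤ (1 + 2 / ε) ^ finrank ℝ E := by
  borelize E
  let μ : Measure E := Measure.addHaar
  have hρ : 0 < 1 + ε / 2 := by positivity
  have hδ : 0 < ε / 2 := by positivity
  set A := ⋃ c ∈ s, ball (c : E) (ε / 2) with hA
  have D : Set.Pairwise (s : Set E) (Function.onFun Disjoint fun c => ball (c : E) (ε / 2)) := by
    rintro c hc d hd hcd
    apply ball_disjoint_ball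
    rw [dist_eq_norm]
    linarith [h c hc d hd hcd]
  have A_subset : A ⊆ ball (0 : E) (1 + ε / 2) := by
    refine Set.iUnion₂_subset fun x hx => ball_subset_ball' ?_
    rw [dist_zero_right]
    linarith [hs x hx]
  have I : (s.card : ENNReal) * ENNReal.ofReal ((ε / 2) ^ finrank ℝ E) * μ (ball 0 1) ≤
      ENNReal.ofReal ((1 + ε / 2) ^ finrank ℝ E) * μ (ball 0 1) :=
    calc
      _ = μ A := by
        rw [hA, measure_biUnion_finset D fun c _ => measurableSet_ball]
        simp only [μ.addHaar_ball_of_pos _ hδ]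
        simp only [Finset.sum_const, nsmul_eq_mul, mul_assoc]
      _ ≤ μ (ball (0 : E) (1 + ε / 2)) := measure_mono A_subset
      _ = _ := by simp only [μ.addHaar_ball_of_pos _ hρ]
  have J := (ENNReal.mul_le_mul_iff_left (measure_ball_pos _ _ zero_lt_one).ne'
    measure_ball_lt_top.ne).1 I
  have K := ENNReal.toReal_le_of_le_ofReal (pow_nonneg hρ.le _) J
  rw [ENNReal.toReal_mul, ENNReal.toReal_natCast,
    ENNReal.toReal_ofReal (by positivity)] at K
  rw [show 1 + 2 / ε = (1 + ε / 2) / (ε / 2) by field_simp; ring, div_pow]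
  rwa [le_div_iff₀ (by positivity)]

/-- A separated subset of the unit sphere of maximal cardinality is a net. -/
theorem exists_finset_net_sphere {ε : ℝ} (hε : 0 < ε) :
    ∃ T : Finset E, (∀ x ∈ T, ‖x‖ = 1) ∧ (∀ x : E, ‖x‖ = 1 → ∃ y ∈ T, ‖x - y‖ < ε) ∧
      (T.card : ℝ) ≤ (1 + 2 / ε) ^ finrank ℝ E := by
  classical
  let p : Finset E → Prop := fun s =>
    (∀ c ∈ s, ‖c‖ = 1) ∧ ∀ c ∈ s, ∀ d ∈ s, c ≠ d → ε ≤ ‖c - d‖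
  have hcard : ∀ s, p s → (s.card : ℝ) ≤ (1 + 2 / ε) ^ finrank ℝ E := fun s hs =>
    card_le_of_separated_of_norm_le_one hε s (fun c hc => (hs.1 c hc).le) hs.2
  have hbdd : BddAbove {n : ℕ | ∃ s, p s ∧ s.card = n} := by
    refine ⟨⌊(1 + 2 / ε) ^ finrank ℝ E⌋₊, ?_⟩
    rintro n ⟨s, hs, rfl⟩
    exact Nat.le_floor (hcard s hs)
  have hne : {n : ℕ | ∃ s, p s ∧ s.card = n}.Nonempty := ⟨0, ∅, by simp [p], rfl⟩
  obtain ⟨T, hT, hTc⟩ := Nat.sSup_mem hne hbdd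
  refine ⟨T, hT.1, fun x hx => ?_, hcard T hT⟩
  by_contra! hcon
  have hxT : x ∉ T := fun hxT => by
    have := hcon x hxT
    simp at this
    linarith
  have hp : p (insert x T) := by
    refine ⟨?_, ?_⟩
    · intro c hc
      rcases Finset.mem_insert.1 hc with rfl | hc
      exacts [hx, hT.1 c hc]
    · intro c hc d hd hcd
      rcases Finset.mem_insert.1 hc with rfl | hc' <;>
        rcases Finset.mem_insert.1 hd with rfl | hd'
      · exact absurd rfl hcd
      · exact hcon d hd'
      · rw [norm_sub_rev]; exact hcon c hc'
      · exact hT.2 c hc' d hd' hcd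
  have := le_csSup hbdd ⟨insert x T, hp, rfl⟩
  rw [Finset.card_insert_of_notMem hxT] at this
  omega

end Net

/-! ### Linear maps with Gaussian columns -/

section RandomMap
open MeasureTheory ProbabilityTheory Module
open scoped RealInnerProductSpace ComplexConjugate

variable {ι H : Type*} [Fintype ι] [NormedAddCommGroup H] [InnerProductSpace ℂ H]

attribute [local instance] InnerProductSpace.complexToReal

/-- The linear map `ℂ^ι → H` sending the `i`-th standard basis vector to `g i`. -/
noncomputable def mapOfColumns (g : PiLp 2 fun _ : ι => H) : EuclideanSpace ℂ ι →ₗ[ℂ] H where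
  toFun w := ∑ i, w i • g i
  map_add' v w := by simp [add_smul, Finset.sum_add_distrib]
  map_smul' c w := by simp [mul_smul, Finset.smul_sum]

theorem mapOfColumns_apply (g : PiLp 2 fun _ : ι => H) (w : EuclideanSpace ℂ ι) :
    mapOfColumns g w = ∑ i, w i • g i := rfl

/-- Evaluation at `w` of the linear map with given columns, as a function of the columns. -/
noncomputable def evalColumns (w : EuclideanSpace ℂ ι) : (PiLp 2 fun _ : ι => H) →L[ℝ] H where
  toFun g := ∑ i, w i • g i
  map_add' g h := by simp [Finset.sum_add_distrib]
  map_smul' c g := by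
    simp only [PiLp.smul_apply, RingHom.id_apply, Finset.smul_sum]
    exact Finset.sum_congr rfl fun i _ => smul_comm _ _ _
  cont := by fun_prop

theorem evalColumns_apply (g : PiLp 2 fun _ : ι => H) (w : EuclideanSpace ℂ ι) :
    evalColumns w g = mapOfColumns g w := rfl

/-- The real adjoint of `evalColumns w`. -/
noncomputable def evalColumnsAdjoint (w : EuclideanSpace ℂ ι) (y : H) : PiLp 2 fun _ : ι => H :=
  WithLp.toLp 2 fun i => conj (w i) • y

theorem inner_evalColumns (w : EuclideanSpace ℂ ι) (g : PiLp 2 fun _ : ι => H) (y : H) :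
    ⟪evalColumns w g, y⟫ = ⟪g, evalColumnsAdjoint w y⟫ := by
  rw [real_inner_eq_re_inner ℂ, real_inner_eq_re_inner ℂ, evalColumns_apply, mapOfColumns_apply,
    sum_inner, PiLp.inner_apply]
  simp [evalColumnsAdjoint, inner_smul_left, inner_smul_right]

theorem norm_evalColumnsAdjoint (w : EuclideanSpace ℂ ι) (y : H) :
    ‖evalColumnsAdjoint w y‖ = ‖w‖ * ‖y‖ := by
  rw [← sq_eq_sq₀ (norm_nonneg _) (by positivity), PiLp.norm_sq_eq_of_L2, mul_pow,
    EuclideanSpace.norm_sq_eq, Finset.sum_mul]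
  simp [evalColumnsAdjoint, norm_smul, mul_pow]

/-- For orthogonal `n` and `u` the adjoints of evaluation at `n` and at `u` have orthogonal ranges. -/
theorem norm_sq_evalColumnsAdjoint_add {n u : EuclideanSpace ℂ ι} (h : inner ℂ n u = 0) (x y : H) :
    ‖evalColumnsAdjoint n x + evalColumnsAdjoint u y‖ ^ 2 =
      (‖n‖ * ‖x‖) ^ 2 + (‖u‖ * ‖y‖) ^ 2 := by
  rw [norm_add_sq_real, norm_evalColumnsAdjoint, norm_evalColumnsAdjoint]
  have : ⟪evalColumnsAdjoint n x, evalColumnsAdjoint u y⟫ = 0 := by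
    have h2 : ∑ i, (starRingEnd ℂ) (u i) * n i = 0 := by
      have := congrArg conj h
      rw [map_zero, inner_conj_symm, PiLp.inner_apply] at this
      simpa [mul_comm] using this
    rw [real_inner_eq_re_inner ℂ, PiLp.inner_apply]
    simp only [evalColumnsAdjoint, inner_smul_left, inner_smul_right, RingHomCompTriple.comp_apply,
      RingHom.id_apply, ← mul_assoc]
    rw [← Finset.sum_mul]
    rw [h2, zero_mul, map_zero]
  rw [this]; ring

theorem norm_sq_sub_norm_sub_sq_le (K : Submodule ℝ H) [K.HasOrthogonalProjection] (y : H) {k : H}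
    (hk : k ∈ K) : ‖y‖ ^ 2 - ‖y - k‖ ^ 2 ≤ ‖K.starProjection y‖ ^ 2 := by
  have h1 := K.norm_sq_eq_add_norm_sq_starProjection y
  have h2 : ‖y - K.starProjection y‖ ≤ ‖y - k‖ := by
    rw [K.starProjection_minimal]
    exact ciInf_le ⟨0, by rintro _ ⟨_, rfl⟩; positivity⟩ (⟨k, hk⟩ : K)
  have h3 : Kᗮ.starProjection y = y - K.starProjection y := by
    rw [K.starProjection_orthogonal']; simp
  rw [h3] at h1
  nlinarith [norm_nonneg (y - K.starProjection y)]

variable [FiniteDimensional ℂ H] [MeasurableSpace H] [BorelSpace H]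

theorem map_evalColumns {w : EuclideanSpace ℂ ι} (hw : ‖w‖ = 1) :
    (stdGaussian (PiLp 2 fun _ : ι => H)).map (evalColumns w) = stdGaussian H :=
  stdGaussian_map_of_coisometry _ (evalColumnsAdjoint w) (inner_evalColumns w)
    fun y => by rw [norm_evalColumnsAdjoint, hw, one_mul]

/-- Unitary invariance of the Gaussian: the images of two orthonormal vectors are independent. -/
theorem map_evalColumns_prodMk {n u : EuclideanSpace ℂ ι} (hn : ‖n‖ = 1) (hu : ‖u‖ = 1)
    (h : inner ℂ n u = 0) :
    (stdGaussian (PiLp 2 fun _ : ι => H)).map (fun g => (evalColumns n g, evalColumns u g)) =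
      (stdGaussian H).prod (stdGaussian H) :=
  stdGaussian_map_prodMk _ _ (evalColumnsAdjoint n) (evalColumnsAdjoint u) (inner_evalColumns n)
    (inner_evalColumns u) fun y₁ y₂ => by
      rw [norm_sq_evalColumnsAdjoint_add h, hn, hu, one_mul, one_mul]

variable {F : Type*} [AddCommGroup F] [Module ℂ F] [FiniteDimensional ℂ F]

/-- The event says that the squared norm of the projection of `y` to the range of `L` exceeds `t`. -/
theorem stdGaussian_exists_range_le (L : F →ₗ[ℂ] H) (t : ℝ) :
    (stdGaussian H).real {y | ∃ f, t < ‖y‖ ^ 2 - ‖y - L f‖ ^ 2} ≤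
      Real.exp (-t / 4) * 2 ^ finrank ℂ F := by
  have hsub : {y : H | ∃ f, t < ‖y‖ ^ 2 - ‖y - L f‖ ^ 2} ⊆
      {y | t ≤ ‖((LinearMap.range L).restrictScalars ℝ).starProjection y‖ ^ 2} := by
    rintro y ⟨f, hf⟩
    exact hf.le.trans (norm_sq_sub_norm_sub_sq_le _ y ⟨f, rfl⟩)
  refine (measureReal_mono hsub).trans
    ((stdGaussian_normSq_starProjection_ge_le _ t).trans ?_)
  gcongr
  have : finrank ℝ ((LinearMap.range L).restrictScalars ℝ) = 2 * finrank ℂ (LinearMap.range L) :=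
    finrank_real_of_complex (LinearMap.range L)
  rw [this, pow_mul, Real.sq_sqrt (by norm_num)]
  exact pow_le_pow_right₀ (by norm_num) (LinearMap.finrank_range_le L)

/-- The subspace to which `p.2` is projected may depend on the independent vector `p.1`. The event is
phrased by an existential quantifier because the projector is not a continuous function of `p.1`,
whereas in this form the event is visibly open. -/
theorem stdGaussian_prod_exists_range_le (Λ : H → F →ₗ[ℂ] H) (hΛ : ∀ f, Continuous fun x => Λ x f)
    (t : ℝ) :
    ((stdGaussian H).prod (stdGaussian H)).real
      {p | ∃ f, t < ‖p.2‖ ^ 2 - ‖p.2 - Λ p.1 f‖ ^ 2} ≤ Real.exp (-t / 4) * 2 ^ finrank ℂ F := by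
  have hopen : IsOpen {p : H × H | ∃ f, t < ‖p.2‖ ^ 2 - ‖p.2 - Λ p.1 f‖ ^ 2} := by
    rw [Set.ofPred_exists]
    refine isOpen_iUnion fun f => isOpen_lt continuous_const ?_
    have := (hΛ f).comp (continuous_fst : Continuous (Prod.fst : H × H → H))
    simp only [Function.comp_def] at this
    fun_prop
  refine ENNReal.toReal_le_of_le_ofReal (by positivity) ?_
  rw [Measure.prod_apply hopen.measurableSet]
  refine (lintegral_mono (g := fun _ => ENNReal.ofReal (Real.exp (-t / 4) * 2 ^ finrank ℂ F))
    fun x => ?_).trans (by simp)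
  rw [← ENNReal.ofReal_toReal (measure_ne_top (stdGaussian H) _)]
  exact ENNReal.ofReal_le_ofReal (stdGaussian_exists_range_le (Λ x) t)

/-- The probabilistic existence argument: if the failure probabilities add up to less than one, some
linear map has nearly constant norm on `T` and, for each pair `p` in `P`, sends `p.2` almost
orthogonally to the range of `Λ (G p.1)`. -/
theorem exists_mapOfColumns (Λ : H → F →ₗ[ℂ] H) (hΛ : ∀ f, Continuous fun x => Λ x f)
    (T : Finset (EuclideanSpace ℂ ι)) (hT : ∀ n ∈ T, ‖n‖ = 1)
    (P : Finset (EuclideanSpace ℂ ι × EuclideanSpace ℂ ι))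
    (hP : ∀ p ∈ P, ‖p.1‖ = 1 ∧ ‖p.2‖ = 1 ∧ inner ℂ p.1 p.2 = 0) (t : ℝ)
    (hsmall : T.card * (Real.exp (-2 * finrank ℂ H) * 2 ^ finrank ℂ H) +
      T.card * (Real.exp (3 / 8 * finrank ℂ H) * (1 / 4) ^ finrank ℂ H) +
      P.card * (Real.exp (-t / 4) * 2 ^ finrank ℂ F) < 1) :
    ∃ G : EuclideanSpace ℂ ι →ₗ[ℂ] H,
      (∀ n ∈ T, (finrank ℂ H : ℝ) / 4 < ‖G n‖ ^ 2 ∧ ‖G n‖ ^ 2 < 8 * finrank ℂ H) ∧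
      ∀ p ∈ P, ∀ f, ‖G p.2‖ ^ 2 - ‖G p.2 - Λ (G p.1) f‖ ^ 2 ≤ t := by
  classical
  set N := finrank ℂ H
  set μ := stdGaussian (PiLp 2 fun _ : ι => H)
  let A (n : EuclideanSpace ℂ ι) : Set (PiLp 2 fun _ : ι => H) :=
    evalColumns n ⁻¹' {x | 8 * (N : ℝ) ≤ ‖x‖ ^ 2}
  let B (n : EuclideanSpace ℂ ι) : Set (PiLp 2 fun _ : ι => H) :=
    evalColumns n ⁻¹' {x | ‖x‖ ^ 2 ≤ (N : ℝ) / 4}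
  let C (p : EuclideanSpace ℂ ι × EuclideanSpace ℂ ι) : Set (PiLp 2 fun _ : ι => H) :=
    (fun g => (evalColumns p.1 g, evalColumns p.2 g)) ⁻¹'
      {q | ∃ f, t < ‖q.2‖ ^ 2 - ‖q.2 - Λ q.1 f‖ ^ 2}
  have hN : finrank ℝ H = 2 * N := finrank_real_of_complex H
  have hA : ∀ n ∈ T, μ.real (A n) ≤ Real.exp (-2 * N) * 2 ^ N := fun n hn => by
    have h := stdGaussian_normSq_ge_le (E := H) (8 * N)
    rw [← map_evalColumns (hT n hn),
      map_measureReal_apply (by fun_prop) (measurableSet_le (by fun_prop) (by fun_prop)), hN,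
      pow_mul, Real.sq_sqrt (by norm_num)] at h
    convert h using 3
    ring
  have hB : ∀ n ∈ T, μ.real (B n) ≤ Real.exp (3 / 8 * N) * (1 / 4) ^ N := fun n hn => by
    have h := stdGaussian_normSq_le_le (E := H) (N / 4)
    rw [← map_evalColumns (hT n hn),
      map_measureReal_apply (by fun_prop) (measurableSet_le (by fun_prop) (by fun_prop)), hN,
      pow_mul] at h
    convert h using 3
    · ring
    · norm_num
  have hC : ∀ p ∈ P, μ.real (C p) ≤ Real.exp (-t / 4) * 2 ^ finrank ℂ F := fun p hp => by
    obtain ⟨h1, h2, h3⟩ := hP p hp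
    have hopen : IsOpen {q : H × H | ∃ f, t < ‖q.2‖ ^ 2 - ‖q.2 - Λ q.1 f‖ ^ 2} := by
      rw [Set.ofPred_exists]
      refine isOpen_iUnion fun f => isOpen_lt continuous_const ?_
      have := (hΛ f).comp (continuous_fst : Continuous (Prod.fst : H × H → H))
      simp only [Function.comp_def] at this
      fun_prop
    have h := stdGaussian_prod_exists_range_le Λ hΛ t
    rwa [← map_evalColumns_prodMk h1 h2 h3,
      map_measureReal_apply (by fun_prop) hopen.measurableSet] at h
  have hunion : μ.real ((⋃ n ∈ T, A n) ∪ (⋃ n ∈ T, B n) ∪ ⋃ p ∈ P, C p) < 1 := by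
    refine lt_of_le_of_lt ?_ hsmall
    refine (measureReal_union_le _ _).trans (add_le_add ((measureReal_union_le _ _).trans
      (add_le_add ?_ ?_)) ?_)
    · refine (measureReal_biUnion_finset_le _ _).trans ((Finset.sum_le_sum hA).trans ?_)
      rw [Finset.sum_const, nsmul_eq_mul]
    · refine (measureReal_biUnion_finset_le _ _).trans ((Finset.sum_le_sum hB).trans ?_)
      rw [Finset.sum_const, nsmul_eq_mul]
    · refine (measureReal_biUnion_finset_le _ _).trans ((Finset.sum_le_sum hC).trans ?_)
      rw [Finset.sum_const, nsmul_eq_mul]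
  obtain ⟨g, hg⟩ : ∃ g, g ∉ (⋃ n ∈ T, A n) ∪ (⋃ n ∈ T, B n) ∪ ⋃ p ∈ P, C p := by
    by_contra! hcon
    rw [Set.eq_univ_of_forall hcon] at hunion
    simp at hunion
  simp only [Set.mem_union, Set.mem_iUnion, not_or, not_exists] at hg
  refine ⟨mapOfColumns g, fun n hn => ⟨?_, ?_⟩, fun p hp f => ?_⟩
  · exact not_le.1 (hg.1.2 n hn)
  · exact not_le.1 (hg.1.1 n hn)
  · by_contra! hcon
    exact hg.2 p hp ⟨f, hcon⟩

end RandomMap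

/-! ### From a map controlled on a net to an isometry -/

section Geometry
open Module

/-- The supremum of `‖B x‖` over the sphere exceeds its maximum over an `η`-net by at most `η ‖B‖`. -/
theorem opNorm_le_of_net {E H : Type*} [NormedAddCommGroup E] [NormedSpace ℂ E]
    [NormedAddCommGroup H] [NormedSpace ℂ H] (B : E →L[ℂ] H) (T : Finset E) {η c : ℝ}
    (hη : η < 1) (hc : 0 ≤ c) (hT : ∀ x : E, ‖x‖ = 1 → ∃ y ∈ T, ‖x - y‖ < η)
    (hB : ∀ y ∈ T, ‖B y‖ ≤ c) : ‖B‖ ≤ c / (1 - η) := by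
  rcases le_or_gt η 0 with h0 | h0
  · refine (B.opNorm_le_of_unit_norm le_rfl fun x hx => ?_).trans (div_nonneg hc (by linarith))
    obtain ⟨y, -, hy⟩ := hT x hx
    linarith [norm_nonneg (x - y)]
  have : ‖B‖ ≤ c + ‖B‖ * η := by
    refine B.opNorm_le_of_unit_norm (by positivity) fun x hx => ?_
    obtain ⟨y, hyT, hy⟩ := hT x hx
    calc ‖B x‖ = ‖B y + B (x - y)‖ := by rw [← map_add]; congr 2; abel
      _ ≤ ‖B y‖ + ‖B (x - y)‖ := norm_add_le _ _
      _ ≤ c + ‖B‖ * η := add_le_add (hB y hyT) ((B.le_opNorm _).trans (by gcongr))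
  rw [le_div_iff₀ (by linarith)]
  linarith

variable {ι H F : Type*} [Fintype ι] [NormedAddCommGroup H] [InnerProductSpace ℂ H]

/-- A component along a vector `x` of `K` can be removed from a vector orthogonal to `x`: the
projection of `y` differs from that of `v` by the orthogonal vector `c • x`. -/
theorem norm_starProjection_le_of_inner_eq_zero (K : Submodule ℂ H)
    [K.HasOrthogonalProjection] {x v y : H} {c : ℂ} (hx : x ∈ K)
    (hv : v = c • x + y) (hxv : inner ℂ x v = 0) : ‖K.starProjection v‖ ≤ ‖K.starProjection y‖ := by
  have h1 : K.starProjection y = K.starProjection v - c • x := by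
    rw [hv, map_add, map_smul, K.starProjection_eq_self_iff.2 hx]
    abel
  have h2 : inner ℂ (K.starProjection v) (c • x) = 0 := by
    rw [K.inner_starProjection_left_eq_right, map_smul, K.starProjection_eq_self_iff.2 hx,
      inner_smul_right, inner_eq_zero_symm.1 hxv, mul_zero]
  have h3 : ‖K.starProjection y‖ ^ 2 = ‖K.starProjection v‖ ^ 2 + ‖c • x‖ ^ 2 := by
    rw [h1, @norm_sub_sq ℂ, h2]
    simp
  exact (sq_le_sq₀ (norm_nonneg _) (norm_nonneg _)).1 (by nlinarith [sq_nonneg ‖c • x‖])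

theorem norm_sub_inv_norm_smul_le {y x : H} (hy : ‖y‖ = 1) (hx : x ≠ 0) :
    ‖y - ((‖x‖⁻¹ : ℝ) : ℂ) • x‖ ≤ 2 * ‖y - x‖ := by
  have hx' : ‖x‖ ≠ 0 := norm_ne_zero_iff.2 hx
  have h1 : ‖x - ((‖x‖⁻¹ : ℝ) : ℂ) • x‖ ≤ ‖y - x‖ := by
    have : x - ((‖x‖⁻¹ : ℝ) : ℂ) • x = ((1 - ‖x‖⁻¹ : ℝ) : ℂ) • x := by
      push_cast
      rw [sub_smul, one_smul]
    rw [this, norm_smul, Complex.norm_real, Real.norm_eq_abs]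
    nth_rw 2 [← abs_norm x]
    rw [← abs_mul, sub_mul, inv_mul_cancel₀ hx', one_mul, ← hy, abs_sub_comm]
    exact abs_norm_sub_norm_le y x
  calc _ = ‖(y - x) + (x - ((‖x‖⁻¹ : ℝ) : ℂ) • x)‖ := by congr 1; abel
    _ ≤ _ := norm_add_le _ _
    _ ≤ _ := by linarith

theorem exists_linearIsometry_range_eq (G : EuclideanSpace ℂ ι →ₗ[ℂ] H)
    (hG : Function.Injective G) :
    ∃ V : EuclideanSpace ℂ ι →ₗᵢ[ℂ] H, ∀ y, y ∈ Set.range V ↔ y ∈ Set.range G := by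
  have hcard : finrank ℂ (LinearMap.range G) = Fintype.card ι := by
    rw [LinearMap.finrank_range_of_inj hG, finrank_euclideanSpace]
  let e : Fin (finrank ℂ (LinearMap.range G)) ≃ ι := Fintype.equivOfCardEq (by simp [hcard])
  let L := ((stdOrthonormalBasis ℂ (LinearMap.range G)).reindex e).repr.symm
  refine ⟨(LinearMap.range G).subtypeₗᵢ.comp L.toLinearIsometry, fun y => ⟨?_, ?_⟩⟩
  · rintro ⟨θ, rfl⟩
    exact (L θ).2
  · intro hy
    refine ⟨L.symm ⟨y, hy⟩, ?_⟩
    simp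

variable [FiniteDimensional ℂ H] [AddCommGroup F] [Module ℂ F]

/-- A linear map `G` that is well conditioned on a net `T`, and for which the images of `n^⊥` are almost
orthogonal to `range (Λ (G n))`, may be replaced by an isometry `V` with the same range. The
distinguished messages `θ'` are those with `V θ'` proportional to `G n` for some `n` in `T`; as `G` is
well conditioned, they are still dense in the sphere up to `lam / 8`. -/
theorem exists_linearIsometry_of_net (Λ : H →ₗ[ℂ] F →ₗ[ℂ] H)
    (hΛ : ∀ x, x ∈ LinearMap.range (Λ x))
    (G : EuclideanSpace ℂ ι →ₗ[ℂ] H) {lam N : ℝ} (hlam : 0 < lam) (hlam' : lam < 1) (hN : 0 < N)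
    (T : Finset (EuclideanSpace ℂ ι)) (hT1 : ∀ n ∈ T, ‖n‖ = 1)
    (hT : ∀ x : EuclideanSpace ℂ ι, ‖x‖ = 1 → ∃ y ∈ T, ‖x - y‖ < lam / 200)
    (hG : ∀ n ∈ T, N / 4 < ‖G n‖ ^ 2 ∧ ‖G n‖ ^ 2 < 8 * N)
    (hGK : ∀ n ∈ T, ∀ w ∈ T, ‖(LinearMap.range (Λ (G n))).starProjection
      (G (w - inner ℂ n w • n))‖ ^ 2 ≤ lam * N / 20) :
    ∃ V : EuclideanSpace ℂ ι →ₗᵢ[ℂ] H, ∀ θ, ‖θ‖ = 1 → ∃ θ', ‖θ'‖ = 1 ∧ ‖θ - θ'‖ ≤ lam / 8 ∧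
      ∀ ψ, inner ℂ θ' ψ = 0 →
        ‖(LinearMap.range (Λ (V θ'))).starProjection (V ψ)‖ ^ 2 ≤ lam / 4 * ‖ψ‖ ^ 2 := by
  let Gc : EuclideanSpace ℂ ι →L[ℂ] H := LinearMap.toContinuousLinearMap G
  have hGc : ∀ z, Gc z = G z := fun z => rfl
  set r := √N with hr
  have hr0 : 0 < r := Real.sqrt_pos.2 hN
  have hrN : r ^ 2 = N := Real.sq_sqrt hN.le
  -- The constants `3` and `0.48` come from `8 N` and `N / 4`, with room for the mesh of the net.
  have hM : ‖Gc‖ ≤ 3 * r := by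
    have h := opNorm_le_of_net Gc T (c := 2.9 * r) (by linarith) (by positivity) hT fun y hy => by
      rw [← sq_le_sq₀ (norm_nonneg _) (by positivity), hGc]
      nlinarith [hG y hy]
    refine h.trans ?_
    rw [div_le_iff₀ (by linarith)]
    nlinarith
  have hGle : ∀ z, ‖G z‖ ≤ 3 * r * ‖z‖ := fun z => (Gc.le_opNorm z).trans (by gcongr)
  have hm1 : ∀ z, ‖z‖ = 1 → 0.48 * r ≤ ‖G z‖ := fun z hz => by
    obtain ⟨n, hn, hzn⟩ := hT z hz
    have h1 : 0.5 * r ≤ ‖G n‖ := by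
      rw [← sq_le_sq₀ (by positivity) (norm_nonneg _)]
      nlinarith [hG n hn]
    have h2 : ‖G n‖ ≤ ‖G z‖ + ‖G (z - n)‖ := by
      rw [map_sub]
      have := norm_sub_le (G z) (G z - G n)
      simpa using this
    have h3 := hGle (z - n)
    nlinarith
  have hm : ∀ z, 0.48 * r * ‖z‖ ≤ ‖G z‖ := fun z => by
    rcases eq_or_ne z 0 with rfl | hz
    · simp
    have hz' : 0 < ‖z‖ := norm_pos_iff.2 hz
    have := hm1 (((‖z‖⁻¹ : ℝ) : ℂ) • z) (by simp [norm_smul, hz'.ne'])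
    rw [map_smul, norm_smul, Complex.norm_real, norm_inv, norm_norm, inv_mul_eq_div,
      le_div_iff₀ hz'] at this
    exact this
  have hinj : Function.Injective G := by
    rw [injective_iff_map_eq_zero]
    intro z hz
    have := hm z
    rw [hz, norm_zero] at this
    by_contra hne
    have : 0 < ‖z‖ := norm_pos_iff.2 hne
    nlinarith [mul_pos hr0 this]
  obtain ⟨V, hV⟩ := exists_linearIsometry_range_eq G hinj
  refine ⟨V, fun θ hθ => ?_⟩
  obtain ⟨z, hz⟩ := (hV (V θ)).1 ⟨θ, rfl⟩
  have hy1 : ‖G z‖ = 1 := by rw [hz, V.norm_map, hθ]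
  have hz0 : 0 < ‖z‖ := by
    rw [norm_pos_iff]
    rintro rfl
    simp at hy1
  have hzr : 0.48 * r * ‖z‖ ≤ 1 := hy1 ▸ hm z
  obtain ⟨n, hn, hzn⟩ := hT (((‖z‖⁻¹ : ℝ) : ℂ) • z) (by simp [norm_smul, hz0.ne'])
  have hGn : 0 < ‖G n‖ := by
    have := hm n
    rw [hT1 n hn] at this
    nlinarith
  have hx0 : ((‖z‖ : ℝ) : ℂ) • G n ≠ 0 :=
    smul_ne_zero (by exact_mod_cast hz0.ne') (norm_pos_iff.1 hGn)
  have hdist : ‖G z - ((‖z‖ : ℝ) : ℂ) • G n‖ ≤ lam / 16 := by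
    have h1 : G z - ((‖z‖ : ℝ) : ℂ) • G n =
        ((‖z‖ : ℝ) : ℂ) • G (((‖z‖⁻¹ : ℝ) : ℂ) • z - n) := by
      rw [map_sub, smul_sub, map_smul, smul_smul, ← Complex.ofReal_mul, mul_inv_cancel₀ hz0.ne',
        Complex.ofReal_one, one_smul]
    rw [h1, norm_smul, Complex.norm_real, norm_norm]
    calc ‖z‖ * ‖G (((‖z‖⁻¹ : ℝ) : ℂ) • z - n)‖
        ≤ ‖z‖ * (3 * r * (lam / 200)) := by
          gcongr
          exact (hGle _).trans (by gcongr)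
      _ ≤ lam / 16 := by nlinarith
  set x : H := ((‖((‖z‖ : ℝ) : ℂ) • G n‖⁻¹ : ℝ) : ℂ) • ((‖z‖ : ℝ) : ℂ) • G n with hx
  obtain ⟨b, hb0, hxb⟩ : ∃ b : ℂ, b ≠ 0 ∧ x = b • G n :=
    ⟨_, mul_ne_zero (Complex.ofReal_ne_zero.2 (inv_ne_zero (norm_ne_zero_iff.2 hx0)))
      (Complex.ofReal_ne_zero.2 hz0.ne'), by rw [hx, smul_smul]⟩
  have hx1 : ‖x‖ = 1 := by
    rw [hx, norm_smul, Complex.norm_real, norm_inv, norm_norm,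
      inv_mul_cancel₀ (norm_ne_zero_iff.2 hx0)]
  obtain ⟨θ', hθ'⟩ := (hV x).2 ⟨b • n, by rw [map_smul, hxb]⟩
  refine ⟨θ', ?_, ?_, fun ψ hψ => ?_⟩
  · rw [← V.norm_map, hθ', hx1]
  · rw [← V.norm_map, map_sub, hθ', ← hz]
    exact (norm_sub_inv_norm_smul_le hy1 hx0).trans (by linarith)
  · have hK : LinearMap.range (Λ (V θ')) = LinearMap.range (Λ (G n)) := by
      rw [hθ', hxb, map_smul, LinearMap.range_smul _ _ hb0]
    rw [hK]
    set K := LinearMap.range (Λ (G n))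
    obtain ⟨u, hu⟩ := (hV (V ψ)).1 ⟨ψ, rfl⟩
    have hGnψ : inner ℂ (G n) (V ψ) = 0 := by
      have : inner ℂ (V θ') (V ψ) = 0 := by rw [V.inner_map_map, hψ]
      rw [hθ', hxb, inner_smul_left] at this
      exact (mul_eq_zero.1 this).resolve_left (by simpa using hb0)
    -- Projecting to `n^⊥` first makes the bound on the net of the whole sphere sufficient.
    let B : EuclideanSpace ℂ ι →L[ℂ] H :=
      K.starProjection ∘L Gc ∘L (ContinuousLinearMap.id ℂ _ - (innerSL ℂ n).smulRight n)
    have hBap : ∀ w, B w = K.starProjection (G (w - inner ℂ n w • n)) := fun w => by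
      simp [B, hGc]
    have hB : ‖B‖ ≤ √(lam * N / 20) / (1 - lam / 200) :=
      opNorm_le_of_net B T (by linarith) (Real.sqrt_nonneg _) hT fun w hw => by
        rw [hBap]
        exact Real.le_sqrt_of_sq_le (hGK n hn w hw)
    have h1 : ‖K.starProjection (V ψ)‖ ≤ ‖B u‖ := by
      rw [hBap]
      refine norm_starProjection_le_of_inner_eq_zero K (hΛ (G n)) (c := inner ℂ n u) ?_ hGnψ
      rw [← hu, map_sub, map_smul]
      abel
    have h2 : 0.48 * r * ‖u‖ ≤ ‖ψ‖ := by
      rw [← V.norm_map ψ, ← hu]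
      exact hm u
    have hB2 : ‖B‖ ^ 2 ≤ lam * N / 19 := by
      refine (pow_le_pow_left₀ (norm_nonneg _) hB 2).trans ?_
      rw [div_pow, Real.sq_sqrt (by positivity), div_le_iff₀ (by nlinarith)]
      have h3 : (19 / 20 : ℝ) ≤ (1 - lam / 200) ^ 2 := by nlinarith
      have : 0 ≤ lam * N / 19 := by positivity
      nlinarith
    have h3 : ‖K.starProjection (V ψ)‖ ≤ ‖B‖ * ‖u‖ := h1.trans (B.le_opNorm u)
    calc ‖K.starProjection (V ψ)‖ ^ 2 ≤ (‖B‖ * ‖u‖) ^ 2 := by gcongr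
      _ = ‖B‖ ^ 2 * ‖u‖ ^ 2 := mul_pow _ _ _
      _ ≤ lam * N / 19 * ‖u‖ ^ 2 := by gcongr
      _ = lam / (19 * 0.48 ^ 2) * (0.48 * r * ‖u‖) ^ 2 := by rw [← hrN]; field_simp
      _ ≤ lam / 4 * ‖ψ‖ ^ 2 := by
        gcongr
        norm_num

end Geometry

/-! ### Numerical estimates for the union bound -/

section Parameters

/-- `τ` is the number of net points, `n` the dimension of the bipartite space and `m` that of the space
of `α × α` arrays; each of the three failure probabilities is at most `exp (-q)`. -/
theorem union_bound_lt_one {lam q τ : ℝ} {n m : ℕ} (hlam' : lam < 1)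
    (hq24 : 24 ≤ q) (hτ0 : 0 ≤ τ) (hτq : τ ≤ Real.exp q) (hn : 1000 * q ≤ lam * n / 100)
    (hm : (m : ℝ) ≤ lam * n / 300) :
    τ * (Real.exp (-2 * n) * 2 ^ n) + τ * (Real.exp (3 / 8 * n) * (1 / 4) ^ n) +
      τ ^ 2 * (Real.exp (-(lam * n / 20) / 4) * 2 ^ m) < 1 := by
  have hlog2' : Real.log 2 < 0.7 := Real.log_two_lt_d9.trans (by norm_num)
  have h2exp : ∀ k : ℕ, (2 : ℝ) ^ k = Real.exp (k * Real.log 2) := fun k => by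
    rw [Real.exp_nat_mul, Real.exp_log (by norm_num)]
  have hn0 : (0 : ℝ) ≤ n := Nat.cast_nonneg n
  have hm0 : (0 : ℝ) ≤ m := Nat.cast_nonneg m
  have hnq : 4 * q ≤ n := by nlinarith
  have hsq : τ ^ 2 ≤ Real.exp (2 * q) := by
    refine (pow_le_pow_left₀ hτ0 hτq 2).trans_eq ?_
    rw [← Real.exp_nat_mul]; norm_num
  have hq4 : Real.exp (-q) < 1 / 4 := by
    have h1 : 4 < Real.exp q := by
      have := Real.add_one_le_exp q
      linarith
    rw [Real.exp_neg, one_div]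
    exact inv_strictAnti₀ (by norm_num) h1
  have t1 : τ * (Real.exp (-2 * n) * 2 ^ n) ≤ Real.exp (-q) := by
    rw [h2exp, ← Real.exp_add]
    refine (mul_le_mul_of_nonneg_right hτq (Real.exp_pos _).le).trans ?_
    rw [← Real.exp_add]
    exact Real.exp_le_exp.2 (by nlinarith)
  have t2 : τ * (Real.exp (3 / 8 * n) * (1 / 4) ^ n) ≤ Real.exp (-q) := by
    have h4 : (1 / 4 : ℝ) ≤ Real.exp (-1) := by
      rw [Real.exp_neg, one_div]
      exact inv_anti₀ (Real.exp_pos _) (by linarith [Real.exp_one_lt_d9])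
    have h5 : (1 / 4 : ℝ) ^ n ≤ Real.exp (n * -1) := by
      rw [Real.exp_nat_mul]
      exact pow_le_pow_left₀ (by norm_num) h4 n
    refine (mul_le_mul hτq (mul_le_mul_of_nonneg_left h5 (Real.exp_pos _).le)
      (by positivity) (Real.exp_pos _).le).trans ?_
    rw [← Real.exp_add, ← Real.exp_add]
    exact Real.exp_le_exp.2 (by linarith)
  have t3 : τ ^ 2 * (Real.exp (-(lam * n / 20) / 4) * 2 ^ m) ≤ Real.exp (-q) := by
    rw [h2exp, ← Real.exp_add]
    refine (mul_le_mul_of_nonneg_right hsq (Real.exp_pos _).le).trans ?_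
    rw [← Real.exp_add]
    refine Real.exp_le_exp.2 ?_
    have : m * Real.log 2 ≤ m * 0.7 := mul_le_mul_of_nonneg_left hlog2'.le hm0
    linarith
  linarith

/-- The number `q = d² (lam / 100)⁴` makes `exp q` a bound for the size of the net, which is the only
place where the size of the message space enters. -/
theorem exists_parameter_bound {lam : ℝ} (hlam : 0 < lam) (hlam' : lam < 1) {d S a : ℕ}
    (hS1 : 1 ≤ S)
    (hS : (S : ℝ) ≤ (d : ℝ) ^ 2 * ((lam / 100) ^ 4 / (4 * Real.logb 2 (100 / lam))))
    (ha : a = ⌊lam * d / 300⌋₊) :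
    ∃ q : ℝ, 24 ≤ q ∧ (1 + 2 / (lam / 200)) ^ (2 * S) ≤ Real.exp q ∧
      1000 * q ≤ lam * (d * a : ℕ) / 100 ∧ ((a * a : ℕ) : ℝ) ≤ lam * (d * a : ℕ) / 300 ∧
      0 < d * a := by
  set X := 100 / lam with hX
  have hX100 : 100 < X := by rw [hX, lt_div_iff₀ hlam]; linarith
  have hlX : lam / 100 = X⁻¹ := by rw [hX, inv_div]
  set l := Real.log X with hl
  have hlog2 : 0 < Real.log 2 := Real.log_pos (by norm_num)
  have hlog2' : Real.log 2 < 0.7 := Real.log_two_lt_d9.trans (by norm_num)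
  have hl6 : 6 * Real.log 2 ≤ l := by
    have : Real.log (2 ^ 6) ≤ l := Real.log_le_log (by norm_num) (by linarith)
    rwa [Real.log_pow] at this
  have hl0 : 0 < l := by linarith
  set q : ℝ := (d : ℝ) ^ 2 * (X⁻¹) ^ 4 with hq
  have hSq : S * (4 * l) ≤ q * Real.log 2 := by
    rw [hlX, Real.logb, ← hl, mul_div_assoc', ← hq, le_div_iff₀ (by positivity)] at hS
    have h := mul_le_mul_of_nonneg_right hS hlog2.le
    calc S * (4 * l) = S * (4 * (l / Real.log 2)) * Real.log 2 := by field_simp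
      _ ≤ _ := h
  have hS1' : (1 : ℝ) ≤ S := by exact_mod_cast hS1
  have hq24 : 24 ≤ q := by
    have : 24 * Real.log 2 ≤ q * Real.log 2 := by nlinarith
    exact le_of_mul_le_mul_right this hlog2
  have hτq : (1 + 2 / (lam / 200)) ^ (2 * S) ≤ Real.exp q := by
    have h1 : 1 + 2 / (lam / 200) ≤ X ^ 2 := by
      have : 2 / (lam / 200) = 4 * X := by rw [hX]; field_simp; norm_num
      rw [this]; nlinarith
    calc (1 + 2 / (lam / 200)) ^ (2 * S) ≤ (X ^ 2) ^ (2 * S) := pow_le_pow_left₀ (by positivity) h1 _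
      _ = Real.exp (S * (4 * l)) := by
        rw [← pow_mul, ← Real.exp_log (show 0 < X by linarith), ← Real.exp_nat_mul, ← hl]
        push_cast
        ring_nf
      _ ≤ Real.exp q := Real.exp_le_exp.2 (by nlinarith)
  have hX0 : 0 < X := by linarith
  have hdq : (d : ℝ) ^ 2 = q * X ^ 4 := by rw [hq]; field_simp
  have hlam_eq : lam = 100 / X := by rw [hX]; field_simp
  have hd : 4 * X ^ 2 ≤ d := by
    rw [← sq_le_sq₀ (by positivity) (by positivity), hdq]
    nlinarith [pow_pos hX0 4]
  have hld : 400 * X ≤ lam * d := by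
    calc 400 * X = lam * (4 * X ^ 2) := by rw [hlam_eq]; field_simp; norm_num
      _ ≤ _ := by gcongr
  have ha1 : (a : ℝ) ≤ lam * d / 300 := ha ▸ Nat.floor_le (by positivity)
  have ha2 : lam * d / 400 ≤ a := by
    have := Nat.lt_floor_add_one (lam * d / 300)
    rw [← ha] at this
    linarith
  have hd0 : (0 : ℝ) < d := by nlinarith [pow_pos hX0 2]
  have ha0 : (0 : ℝ) < a := by linarith
  refine ⟨q, hq24, hτq, ?_, ?_, by exact_mod_cast mul_pos hd0 ha0⟩
  · have h1 : lam * (d * (lam * d / 400)) ≤ lam * (d * a) := by gcongr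
    have h2 : lam * (d * (lam * d / 400)) = 25 * X ^ 2 * q := by
      calc _ = lam ^ 2 / 400 * (d : ℝ) ^ 2 := by ring
        _ = _ := by rw [hdq, hlam_eq]; field_simp; norm_num
    have h3 : 10000 * q ≤ X ^ 2 * q := by
      gcongr
      nlinarith
    push_cast
    linarith
  · push_cast
    nlinarith

end Parameters

/-! ### The channel of an isometry -/

section Encoder
variable {ι κ α : Type*} [Fintype ι] [Fintype α]

/-- The linear map `X ↦ Tr_α (V X V*)`. -/
noncomputable def partialTraceConj (V : Matrix (κ × α) ι ℂ) :
    Matrix ι ι ℂ →ₗ[ℂ] Matrix κ κ ℂ where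
  toFun X := partialTraceRight (V * X * Vᴴ)
  map_add' X Y := by
    ext i j
    simp [partialTraceRight, Matrix.mul_add, Matrix.add_mul, Finset.sum_add_distrib]
  map_smul' c X := by
    ext i j
    simp [partialTraceRight, Finset.mul_sum]

theorem partialTraceConj_apply (V : Matrix (κ × α) ι ℂ) (X : Matrix ι ι ℂ) :
    partialTraceConj V X = partialTraceRight (V * X * Vᴴ) := rfl

theorem cstarMatrix_sum_apply {m n A β : Type*} [AddCommMonoid A] (s : Finset β)
    (f : β → CStarMatrix m n A) (i : m) (j : n) : (∑ b ∈ s, f b) i j = ∑ b ∈ s, f b i j := by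
  classical
  induction s using Finset.induction_on with
  | empty => simp [CStarMatrix.zero_apply]
  | insert b s hb ih => rw [Finset.sum_insert hb, Finset.sum_insert hb, CStarMatrix.add_apply, ih]

theorem partialTraceConj_star_mul_apply (V : Matrix (κ × α) ι ℂ) (C D : Matrix ι ι ℂ) (p q : κ) :
    partialTraceConj V (star C * D) p q =
      ∑ a, ∑ s, star ((C * Vᴴ) s (p, a)) * (D * Vᴴ) s (q, a) := by
  rw [partialTraceConj_apply, Matrix.star_eq_conjTranspose,
    show V * (Cᴴ * D) * Vᴴ = (C * Vᴴ)ᴴ * (D * Vᴴ) by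
      rw [Matrix.conjTranspose_mul, Matrix.conjTranspose_conjTranspose]
      simp only [Matrix.mul_assoc]]
  simp only [partialTraceRight, Matrix.of_apply]
  refine Finset.sum_congr rfl fun a _ => ?_
  rw [Matrix.mul_apply]
  rfl

variable [Fintype κ]

theorem trace_partialTraceRight (Y : Matrix (κ × α) (κ × α) ℂ) :
    (partialTraceRight Y).trace = Y.trace := by
  simp [Matrix.trace, partialTraceRight, Fintype.sum_prod_type]

variable [DecidableEq κ]

/-- Gram matrices of families of vectors, with rank-one blocks, are positive. -/
theorem cstarMatrix_gram_nonneg {n : Type*} [Fintype n] [DecidableEq n] (r : n → κ → ℂ) :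
    0 ≤ (CStarMatrix.ofMatrix fun i j => Matrix.vecMulVec (star (r i)) (r j) :
      CStarMatrix n n (Matrix κ κ ℂ)) := by
  rcases isEmpty_or_nonempty κ with hκ | ⟨⟨p₀⟩⟩
  · refine le_of_eq ?_
    ext i j p
    exact hκ.elim p
  rcases isEmpty_or_nonempty n with hn | ⟨⟨l⟩⟩
  · refine le_of_eq ?_
    ext i
    exact hn.elim i
  -- Since the blocks have to be square, the Gram matrix is factored through a block matrix supported
  -- on one block row, each block being supported on one row.
  let R : CStarMatrix n n (Matrix κ κ ℂ) :=
    CStarMatrix.ofMatrix fun m j => if m = l then Matrix.vecMulVec (Pi.single p₀ 1) (r j) else 0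
  have hR : (CStarMatrix.ofMatrix fun i j => Matrix.vecMulVec (star (r i)) (r j)) = star R * R := by
    refine CStarMatrix.ext fun i j => ?_
    rw [CStarMatrix.mul_apply, Finset.sum_eq_single l]
    · have hl : ∀ j, R l j = Matrix.vecMulVec (Pi.single p₀ 1) (r j) := fun j => if_pos rfl
      rw [CStarMatrix.star_apply, hl, hl, Matrix.star_eq_conjTranspose,
        Matrix.conjTranspose_vecMulVec, Matrix.vecMulVec_mul_vecMulVec]
      simp
      rfl
    · intro m _ hm
      have h0 : R m j = 0 := if_neg hm
      rw [h0, mul_zero]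
    · simp
  rw [hR]
  exact star_mul_self_nonneg R

variable [DecidableEq ι]

/-- Complete positivity: on `star C * C` the map is a sum of Gram matrices with rank-one blocks, one
for each block row of `C`, each basis vector of the traced out factor and each row. -/
theorem map_partialTraceConj_nonneg (V : Matrix (κ × α) ι ℂ) (k : ℕ)
    (M : CStarMatrix (Fin k) (Fin k) (Matrix ι ι ℂ)) (hM : 0 ≤ M) :
    0 ≤ M.map (partialTraceConj V) := by
  rw [StarOrderedRing.nonneg_iff] at hM
  induction hM using AddSubmonoid.closure_induction with
  | zero =>
    refine le_of_eq (CStarMatrix.ext fun i j => ?_)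
    exact (map_zero (partialTraceConj V)).symm
  | add M N _ _ hM hN =>
    refine (add_nonneg hM hN).trans_eq (CStarMatrix.ext fun i j => ?_)
    exact (map_add (partialTraceConj V) (M i j) (N i j)).symm
  | mem M hM =>
    obtain ⟨C, rfl⟩ := hM
    let c (l j : Fin k) : Matrix ι ι ℂ := C l j
    have key : (star C * C).map (partialTraceConj V) = ∑ l, ∑ a, ∑ s, CStarMatrix.ofMatrix
        fun i j => Matrix.vecMulVec (star fun p => (c l i * Vᴴ) s (p, a))
          (fun p => (c l j * Vᴴ) s (p, a)) := by
      refine CStarMatrix.ext fun i j => ?_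
      have h1 : (star C * C).map (partialTraceConj V) i j =
          partialTraceConj V (∑ l, star (c l i) * c l j) := rfl
      rw [h1, map_sum, cstarMatrix_sum_apply]
      refine Finset.sum_congr rfl fun l _ => ?_
      rw [cstarMatrix_sum_apply]
      ext p q
      rw [partialTraceConj_star_mul_apply, Matrix.sum_apply]
      refine Finset.sum_congr rfl fun a _ => ?_
      rw [cstarMatrix_sum_apply, Matrix.sum_apply]
      rfl
    rw [key]
    exact Finset.sum_nonneg fun l _ => Finset.sum_nonneg fun a _ => Finset.sum_nonneg fun s _ =>
      cstarMatrix_gram_nonneg fun i p => (c l i * Vᴴ) s (p, a)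

/-- The channel `X ↦ Tr_α (V X V*)` of an isometry `V`. -/
noncomputable def isometryChannel (V : Matrix (κ × α) ι ℂ) (hV : Vᴴ * V = 1) :
    Channel ι κ where
  toCP :=
    { partialTraceConj V with
      map_cstarMatrix_nonneg' := map_partialTraceConj_nonneg V }
  trace_map X := by
    change (partialTraceRight (V * X * Vᴴ)).trace = X.trace
    rw [trace_partialTraceRight, Matrix.trace_mul_comm, ← Matrix.mul_assoc, hV, Matrix.one_mul]

theorem isometryChannel_toCP_apply (V : Matrix (κ × α) ι ℂ) (hV : Vᴴ * V = 1)
    (X : Matrix ι ι ℂ) :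
    (isometryChannel V hV).toCP X = partialTraceRight (V * X * Vᴴ) := rfl

end Encoder

/-! ### Support projectors -/

section Support
variable {κ : Type*} [Fintype κ]

theorem exists_isSupportProjector [DecidableEq κ] (ρ : Matrix κ κ ℂ) :
    ∃ D, IsSupportProjector D ρ := by
  let U := LinearMap.range (Matrix.toEuclideanLin ρ)
  let e := Matrix.toEuclideanCLM (n := κ) (𝕜 := ℂ)
  refine ⟨e.symm U.starProjection, ?_, ?_⟩
  · have h := isStarProjection_starProjection (U := U)
    refine ⟨?_, ?_⟩
    · rw [IsIdempotentElem, ← map_mul, h.isIdempotentElem.eq]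
    · exact (e.symm.map_star' _).symm.trans (congrArg e.symm h.isSelfAdjoint.star_eq)
  · have hD : ∀ v : EuclideanSpace ℂ κ, (e.symm U.starProjection) *ᵥ v.ofLp =
        (U.starProjection v).ofLp := fun v => by
      have := Matrix.ofLp_toEuclideanCLM (e.symm U.starProjection) v
      rw [← this]
      congr 2
      exact e.apply_symm_apply _
    ext v
    constructor
    · rintro ⟨u, rfl⟩
      have h := hD (WithLp.toLp 2 u)
      obtain ⟨w, hw⟩ := (U.starProjection_apply_mem (WithLp.toLp 2 u))
      refine ⟨w.ofLp, ?_⟩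
      rw [Matrix.mulVecLin_apply, Matrix.mulVecLin_apply]
      erw [h, ← hw]
      rfl
    · rintro ⟨u, rfl⟩
      refine ⟨ρ *ᵥ u, ?_⟩
      rw [Matrix.mulVecLin_apply, Matrix.mulVecLin_apply]
      have h := hD (WithLp.toLp 2 (ρ *ᵥ u))
      erw [h, U.starProjection_eq_self_iff.2 ⟨WithLp.toLp 2 u, rfl⟩]
      rfl

theorem IsSupportProjector.exists_eq_mul [DecidableEq κ] {D ρ : Matrix κ κ ℂ}
    (h : IsSupportProjector D ρ) : ∃ Y, D = ρ * Y := by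
  have : ∀ j, ∃ y, ρ *ᵥ y = D *ᵥ (Pi.single j 1) := fun j => by
    have hj : D *ᵥ (Pi.single j 1) ∈ LinearMap.range D.mulVecLin := ⟨_, rfl⟩
    rw [h.2] at hj
    exact hj
  choose y hy using this
  refine ⟨(Matrix.of y)ᵀ, ?_⟩
  ext i j
  have := congrFun (hy j) i
  rw [Matrix.mulVec_single_one] at this
  exact this.symm

theorem IsSupportProjector.mul_eq [DecidableEq κ] {D ρ : Matrix κ κ ℂ}
    (h : IsSupportProjector D ρ) : D * ρ = ρ := by
  ext i j
  have hj : ρ *ᵥ (Pi.single j 1) ∈ LinearMap.range ρ.mulVecLin := ⟨_, rfl⟩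
  rw [← h.2] at hj
  obtain ⟨u, hu⟩ := hj
  rw [Matrix.mulVecLin_apply] at hu
  have h1 : (D * ρ) *ᵥ (Pi.single j 1) = ρ *ᵥ (Pi.single j 1) := by
    rw [← Matrix.mulVec_mulVec, ← hu, Matrix.mulVec_mulVec, h.1.isIdempotentElem.eq]
  have := congrFun h1 i
  rwa [Matrix.mulVec_single_one, Matrix.mulVec_single_one] at this

end Support

/-! ### Bipartite vectors as matrices -/

section Bipartite
variable {κ α : Type*}

/-- The `κ × α` matrix of a vector in `ℂ^κ ⊗ ℂ^α`. -/
noncomputable def toMat : EuclideanSpace ℂ (κ × α) ≃ₗ[ℂ] Matrix κ α ℂ where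
  toFun x := Matrix.of fun i k => x (i, k)
  invFun M := WithLp.toLp 2 fun p => M p.1 p.2
  map_add' _ _ := rfl
  map_smul' _ _ := rfl
  left_inv _ := rfl
  right_inv _ := rfl

theorem toMat_apply (x : EuclideanSpace ℂ (κ × α)) (i : κ) (k : α) : toMat x i k = x (i, k) := rfl

variable [Fintype α]

/-- The Euclidean inner product is the Hilbert–Schmidt inner product of the matrices. -/
theorem inner_eq_trace [Fintype κ] (x y : EuclideanSpace ℂ (κ × α)) :
    inner ℂ x y = ((toMat x)ᴴ * toMat y).trace := by
  rw [PiLp.inner_apply, Fintype.sum_prod_type, Finset.sum_comm]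
  simp only [Matrix.trace, Matrix.diag_apply, Matrix.mul_apply, Matrix.conjTranspose_apply,
    toMat_apply]
  refine Finset.sum_congr rfl fun k _ => Finset.sum_congr rfl fun i _ => ?_
  rw [RCLike.inner_apply, mul_comm]
  rfl

/-- The bilinear map sending a vector `x` of `ℂ^κ ⊗ ℂ^α` and an `α × α` array `T` to the vector
with matrix `toMat x * T`. -/
noncomputable def columnAction :
    EuclideanSpace ℂ (κ × α) →ₗ[ℂ] (α → α → ℂ) →ₗ[ℂ] EuclideanSpace ℂ (κ × α) :=
  LinearMap.mk₂ ℂ (fun x T => toMat.symm (toMat x * Matrix.of T))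
    (fun x y T => by rw [map_add, Matrix.add_mul, map_add])
    (fun c x T => by rw [map_smul, Matrix.smul_mul, map_smul])
    (fun x T U => by rw [← Matrix.of_add_of, Matrix.mul_add, map_add])
    (fun c x T => by rw [← Matrix.smul_of, Matrix.mul_smul, map_smul])

theorem columnAction_apply (x : EuclideanSpace ℂ (κ × α)) (T : α → α → ℂ) :
    columnAction x T = toMat.symm (toMat x * Matrix.of T) := rfl

theorem mem_range_columnAction [DecidableEq α] (x : EuclideanSpace ℂ (κ × α)) :
    x ∈ LinearMap.range (columnAction x) :=
  ⟨Matrix.of.symm 1, by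
    rw [columnAction_apply, Equiv.apply_symm_apply, Matrix.mul_one, LinearEquiv.symm_apply_apply]⟩

theorem toEuclideanLin_symm_mulVec {ι β : Type*} [Fintype ι] [DecidableEq ι]
    (V : EuclideanSpace ℂ ι →ₗ[ℂ] EuclideanSpace ℂ β) (φ : EuclideanSpace ℂ ι) :
    (Matrix.toEuclideanLin.symm V) *ᵥ φ.ofLp = (V φ).ofLp :=
  congrArg (fun L => (L φ).ofLp) (Matrix.toEuclideanLin.apply_symm_apply V)

/-- The encoding of a pure state, in terms of the matrix of its image under the isometry. -/
theorem partialTraceRight_conj_pure {ι : Type*} [Fintype ι] [DecidableEq ι]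
    (V : EuclideanSpace ℂ ι →ₗ[ℂ] EuclideanSpace ℂ (κ × α)) (φ : EuclideanSpace ℂ ι) :
    partialTraceRight (Matrix.toEuclideanLin.symm V * Matrix.vecMulVec ⇑φ (star ⇑φ) *
      (Matrix.toEuclideanLin.symm V)ᴴ) = toMat (V φ) * (toMat (V φ))ᴴ := by
  have h := toEuclideanLin_symm_mulVec V φ
  rw [Matrix.mul_vecMulVec, Matrix.vecMulVec_mul, ← Matrix.star_mulVec, h]
  ext i j
  simp [partialTraceRight, Matrix.vecMulVec_apply, Matrix.mul_apply, toMat_apply]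

variable [Fintype κ]

/-- If `D` is the support projector of the reduced state of `x`, then `D ⊗ 1` is the orthogonal
projector onto the range of `columnAction x`. -/
theorem starProjection_range_columnAction [DecidableEq κ] {D : Matrix κ κ ℂ}
    {x : EuclideanSpace ℂ (κ × α)} (hD : IsSupportProjector D (toMat x * (toMat x)ᴴ))
    (v : EuclideanSpace ℂ (κ × α)) :
    (LinearMap.range (columnAction x)).starProjection v = toMat.symm (D * toMat v) := by
  have hDx : D * toMat x = toMat x := by
    have h1 : (D - 1) * (toMat x * (toMat x)ᴴ) = 0 := by
      rw [Matrix.sub_mul, hD.mul_eq, Matrix.one_mul, sub_self]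
    have h2 : (D - 1) * toMat x = 0 := (Matrix.mul_self_mul_conjTranspose_eq_zero _ _).1 h1
    rwa [Matrix.sub_mul, Matrix.one_mul, sub_eq_zero] at h2
  have hDh : Dᴴ = D := hD.1.isSelfAdjoint
  obtain ⟨Y, hY⟩ := hD.exists_eq_mul
  refine Submodule.eq_starProjection_of_mem_of_inner_eq_zero ?_ ?_
  · refine ⟨Matrix.of.symm ((toMat x)ᴴ * Y * toMat v), ?_⟩
    rw [columnAction_apply, hY, Equiv.apply_symm_apply]
    simp only [Matrix.mul_assoc]
  · rintro w ⟨T, rfl⟩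
    rw [inner_eq_trace, map_sub, columnAction_apply, LinearEquiv.apply_symm_apply,
      LinearEquiv.apply_symm_apply, Matrix.conjTranspose_sub, Matrix.conjTranspose_mul, hDh,
      Matrix.sub_mul, Matrix.mul_assoc, ← Matrix.mul_assoc D, hDx, sub_self, Matrix.trace_zero]

/-- The acceptance probability of the test `D` is a squared norm of a projection. -/
theorem trace_mul_supportProjector [DecidableEq κ] {D : Matrix κ κ ℂ}
    {x : EuclideanSpace ℂ (κ × α)} (hD : IsSupportProjector D (toMat x * (toMat x)ᴴ))
    (v : EuclideanSpace ℂ (κ × α)) :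
    (toMat v * (toMat v)ᴴ * D).trace =
      ((‖(LinearMap.range (columnAction x)).starProjection v‖ ^ 2 : ℝ) : ℂ) := by
  have hDh : Dᴴ = D := hD.1.isSelfAdjoint
  have hDD : D * D = D := hD.1.isIdempotentElem
  rw [starProjection_range_columnAction hD]
  have h := inner_self_eq_norm_sq_to_K (𝕜 := ℂ) (toMat.symm (D * toMat v))
  push_cast
  rw [show ((‖toMat.symm (D * toMat v)‖ : ℝ) : ℂ) ^ 2 = _ from h.symm, inner_eq_trace,
    LinearEquiv.apply_symm_apply, Matrix.conjTranspose_mul, hDh, Matrix.mul_assoc,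
    Matrix.mul_assoc, ← Matrix.mul_assoc D D, hDD, Matrix.trace_mul_comm, Matrix.mul_assoc]

end Bipartite

/-! ### Error of the code -/

section Final
open Module

/-- The overlap of two pure states. -/
theorem trace_mul_pure {ι : Type*} [Fintype ι] (φ θ : EuclideanSpace ℂ ι) :
    (Matrix.vecMulVec ⇑φ (star ⇑φ) * Matrix.vecMulVec ⇑θ (star ⇑θ)).trace =
      ((‖inner ℂ θ φ‖ ^ 2 : ℝ) : ℂ) := by
  rw [Matrix.vecMulVec_mul_vecMulVec, Matrix.vecMulVec_smul, Matrix.trace_smul, Matrix.trace_vecMulVec]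
  have h1 : ∀ x y : EuclideanSpace ℂ ι, star ⇑x ⬝ᵥ ⇑y = inner ℂ x y := fun x y => by
    rw [EuclideanSpace.inner_eq_star_dotProduct, dotProduct_comm]
  rw [dotProduct_comm _ (star _), h1, h1, smul_eq_mul, ← inner_conj_symm φ θ]
  rw [Complex.conj_mul']
  push_cast
  rfl

/-- Decomposing `φ` along `θ'` and its complement, the acceptance probability has no cross term,
because `V θ'` lies in `K`; it is `|⟨θ', φ⟩|²` up to the small contribution of the complement. -/
theorem abs_overlap_sub_le {X H : Type*} [NormedAddCommGroup X] [InnerProductSpace ℂ X]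
    [NormedAddCommGroup H] [InnerProductSpace ℂ H] (V : X →ₗᵢ[ℂ] H) (K : Submodule ℂ H)
    [K.HasOrthogonalProjection] {lam : ℝ} (hlam : 0 ≤ lam) {φ θ θ' : X} (hφ : ‖φ‖ = 1)
    (hθ : ‖θ‖ = 1) (hθ' : ‖θ'‖ = 1) (hK : V θ' ∈ K) (hdist : ‖θ - θ'‖ ≤ lam / 8)
    (hsmall : ∀ ψ, inner ℂ θ' ψ = 0 → ‖K.starProjection (V ψ)‖ ^ 2 ≤ lam / 4 * ‖ψ‖ ^ 2) :
    |‖inner ℂ θ φ‖ ^ 2 - ‖K.starProjection (V φ)‖ ^ 2| ≤ lam / 2 := by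
  set c : ℂ := inner ℂ θ' φ with hc
  set ψ := φ - c • θ' with hψ
  have hθψ : inner ℂ θ' ψ = 0 := by
    rw [hψ, inner_sub_right, inner_smul_right, inner_self_eq_norm_sq_to_K, hθ', ← hc]
    simp
  have hφψ : φ = c • θ' + ψ := by rw [hψ]; abel
  have horth : inner ℂ (c • V θ') (K.starProjection (V ψ)) = 0 := by
    rw [inner_smul_left, ← K.inner_starProjection_left_eq_right, K.starProjection_eq_self_iff.2 hK,
      V.inner_map_map, hθψ, mul_zero]
  have h1 : ‖K.starProjection (V φ)‖ ^ 2 = ‖c‖ ^ 2 + ‖K.starProjection (V ψ)‖ ^ 2 := by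
    have : K.starProjection (V φ) = c • V θ' + K.starProjection (V ψ) := by
      conv_lhs => rw [hφψ]
      rw [map_add, map_smul, map_add, map_smul, K.starProjection_eq_self_iff.2 hK]
    rw [this, @norm_add_sq ℂ, horth, norm_smul, V.norm_map, hθ']
    simp
  have h2 : ‖ψ‖ ^ 2 ≤ 1 := by
    have h := hφψ
    have h0 : inner ℂ (c • θ') ψ = 0 := by rw [inner_smul_left, hθψ, mul_zero]
    have h3 : ‖φ‖ ^ 2 = ‖c • θ'‖ ^ 2 + ‖ψ‖ ^ 2 := by
      conv_lhs => rw [hφψ]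
      rw [@norm_add_sq ℂ, h0]
      simp
    rw [hφ] at h3
    nlinarith [sq_nonneg ‖c • θ'‖]
  have h3 : ‖K.starProjection (V ψ)‖ ^ 2 ≤ lam / 4 := (hsmall ψ hθψ).trans (by nlinarith)
  have h4 : |‖inner ℂ θ φ‖ - ‖c‖| ≤ lam / 8 := by
    refine (abs_norm_sub_norm_le _ _).trans ?_
    rw [hc, ← inner_sub_left]
    refine (norm_inner_le_norm _ _).trans ?_
    rwa [hφ, mul_one]
  have h5 : ‖inner ℂ θ φ‖ ≤ 1 := (norm_inner_le_norm _ _).trans (by rw [hθ, hφ, one_mul])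
  have h6 : ‖c‖ ≤ 1 := (norm_inner_le_norm _ _).trans (by rw [hθ', hφ, one_mul])
  have h7 : |‖inner ℂ θ φ‖ ^ 2 - ‖c‖ ^ 2| ≤ lam / 4 := by
    rw [sq_sub_sq, abs_mul, abs_of_nonneg (by positivity)]
    nlinarith [abs_nonneg (‖inner ℂ θ φ‖ - ‖c‖), norm_nonneg c, norm_nonneg (inner ℂ θ φ)]
  rw [h1]
  rw [abs_le] at h7 ⊢
  constructor <;> linarith [h7.1, h7.2, sq_nonneg ‖K.starProjection (V ψ)‖]

theorem inner_sub_smul_eq_zero {X : Type*} [NormedAddCommGroup X] [InnerProductSpace ℂ X]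
    {n : X} (hn : ‖n‖ = 1) (w : X) : inner ℂ n (w - inner ℂ n w • n) = 0 := by
  rw [inner_sub_right, inner_smul_right, inner_self_eq_norm_sq_to_K, hn]
  simp

theorem norm_sub_inner_smul_le {X : Type*} [NormedAddCommGroup X] [InnerProductSpace ℂ X]
    {n : X} (hn : ‖n‖ = 1) (w : X) : ‖w - inner ℂ n w • n‖ ≤ ‖w‖ := by
  have h5 : w = inner ℂ n w • n + (w - inner ℂ n w • n) := by abel
  have h6 : inner ℂ (inner ℂ n w • n) (w - inner ℂ n w • n) = 0 := by
    rw [inner_smul_left, inner_sub_smul_eq_zero hn, mul_zero]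
  have h7 : ‖w‖ ^ 2 = ‖inner ℂ n w • n‖ ^ 2 + ‖w - inner ℂ n w • n‖ ^ 2 := by
    conv_lhs => rw [h5]
    rw [@norm_add_sq ℂ, h6]
    simp
  rw [← sq_le_sq₀ (norm_nonneg _) (norm_nonneg _)]
  nlinarith [sq_nonneg ‖inner ℂ n w • n‖]

/-- `exists_mapOfColumns` for the pairs formed by a net point and the normalized projection of another
net point to its orthogonal complement. -/
theorem exists_map_of_net {ι H F : Type*} [Fintype ι] [NormedAddCommGroup H]
    [InnerProductSpace ℂ H] [FiniteDimensional ℂ H] [AddCommGroup F] [Module ℂ F]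
    [FiniteDimensional ℂ F] (Λ : H →ₗ[ℂ] F →ₗ[ℂ] H) (T : Finset (EuclideanSpace ℂ ι))
    (hT : ∀ n ∈ T, ‖n‖ = 1) {t : ℝ} (ht : 0 ≤ t)
    (hsmall : T.card * (Real.exp (-2 * finrank ℂ H) * 2 ^ finrank ℂ H) +
      T.card * (Real.exp (3 / 8 * finrank ℂ H) * (1 / 4) ^ finrank ℂ H) +
      (T.card : ℝ) ^ 2 * (Real.exp (-t / 4) * 2 ^ finrank ℂ F) < 1) :
    ∃ G : EuclideanSpace ℂ ι →ₗ[ℂ] H,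
      (∀ n ∈ T, (finrank ℂ H : ℝ) / 4 < ‖G n‖ ^ 2 ∧ ‖G n‖ ^ 2 < 8 * finrank ℂ H) ∧
      ∀ n ∈ T, ∀ w ∈ T, ‖(LinearMap.range (Λ (G n))).starProjection
        (G (w - inner ℂ n w • n))‖ ^ 2 ≤ t := by
  classical
  let proj (n w : EuclideanSpace ℂ ι) : EuclideanSpace ℂ ι := w - inner ℂ n w • n
  let P : Finset (EuclideanSpace ℂ ι × EuclideanSpace ℂ ι) :=
    ((T ×ˢ T).filter fun p => proj p.1 p.2 ≠ 0).image
      fun p => (p.1, ((‖proj p.1 p.2‖⁻¹ : ℝ) : ℂ) • proj p.1 p.2)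
  have hPcard : (P.card : ℝ) ≤ (T.card : ℝ) ^ 2 := by
    have : P.card ≤ T.card * T.card :=
      Finset.card_image_le.trans ((Finset.card_filter_le _ _).trans (Finset.card_product _ _).le)
    rw [sq]
    exact_mod_cast this
  have hP : ∀ p ∈ P, ‖p.1‖ = 1 ∧ ‖p.2‖ = 1 ∧ inner ℂ p.1 p.2 = 0 := fun p hp => by
    obtain ⟨p', hp', rfl⟩ := Finset.mem_image.1 hp
    obtain ⟨hp1, hp2⟩ := Finset.mem_filter.1 hp'
    have h1 := hT _ (Finset.mem_product.1 hp1).1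
    have hn : ‖proj p'.1 p'.2‖ ≠ 0 := norm_ne_zero_iff.2 hp2
    refine ⟨h1, ?_, ?_⟩
    · rw [norm_smul, Complex.norm_real, norm_inv, norm_norm, inv_mul_cancel₀ hn]
    · rw [inner_smul_right, inner_sub_smul_eq_zero h1, mul_zero]
  borelize H
  obtain ⟨G, hG1, hG2⟩ := exists_mapOfColumns (fun x => Λ x)
    (fun f => (Λ.flip f).continuous_of_finiteDimensional) T hT P hP t
    (lt_of_le_of_lt (by gcongr) hsmall)
  refine ⟨G, hG1, fun n hn w hw => ?_⟩
  change ‖(LinearMap.range (Λ (G n))).starProjection (G (proj n w))‖ ^ 2 ≤ t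
  set K := LinearMap.range (Λ (G n))
  rcases eq_or_ne (proj n w) 0 with h0 | h0
  · rw [h0]
    simpa using ht
  set u := ((‖proj n w‖⁻¹ : ℝ) : ℂ) • proj n w with hu
  have hmem : (n, u) ∈ P := Finset.mem_image.2 ⟨(n, w), Finset.mem_filter.2
    ⟨Finset.mem_product.2 ⟨hn, hw⟩, h0⟩, rfl⟩
  obtain ⟨f, hf⟩ : K.starProjection (G u) ∈ K := K.starProjection_apply_mem _
  have h1 : ‖G u‖ ^ 2 - ‖G u - Λ (G n) f‖ ^ 2 ≤ t := hG2 _ hmem f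
  rw [hf] at h1
  have h2 : ‖G u‖ ^ 2 = ‖K.starProjection (G u)‖ ^ 2 + ‖G u - K.starProjection (G u)‖ ^ 2 := by
    have := K.norm_sq_eq_add_norm_sq_starProjection (G u)
    rwa [K.starProjection_orthogonal'] at this
  have hnz : ‖proj n w‖ ≠ 0 := norm_ne_zero_iff.2 h0
  have h3 : proj n w = ((‖proj n w‖ : ℝ) : ℂ) • u := by
    rw [hu, smul_smul, ← Complex.ofReal_mul, mul_inv_cancel₀ hnz, Complex.ofReal_one, one_smul]
  have h4 : ‖proj n w‖ ≤ 1 := (norm_sub_inner_smul_le (hT n hn) w).trans (hT w hw).le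
  have h8 : ‖proj n w‖ ^ 2 ≤ 1 := pow_le_one₀ (norm_nonneg _) h4
  rw [h3, map_smul, map_smul, norm_smul, Complex.norm_real, norm_norm, mul_pow]
  nlinarith [sq_nonneg ‖K.starProjection (G u)‖]

/-- The isometry of the code, for a target space `H` of dimension `d * a` and a bilinear map `Λ` such
that `range (Λ x)` contains `x` and has dimension at most `a * a`. -/
theorem exists_linearIsometry_code {H F : Type*} [NormedAddCommGroup H]
    [InnerProductSpace ℂ H] [FiniteDimensional ℂ H] [AddCommGroup F] [Module ℂ F]
    [FiniteDimensional ℂ F] (Λ : H →ₗ[ℂ] F →ₗ[ℂ] H) (hΛ : ∀ x, x ∈ LinearMap.range (Λ x))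
    {lam : ℝ} (hlam : 0 < lam) (hlam' : lam < 1) {d S a : ℕ} (hS1 : 1 ≤ S)
    (hS : (S : ℝ) ≤ (d : ℝ) ^ 2 * ((lam / 100) ^ 4 / (4 * Real.logb 2 (100 / lam))))
    (ha : a = ⌊lam * d / 300⌋₊) (hH : finrank ℂ H = d * a) (hF : finrank ℂ F = a * a) :
    ∃ V : EuclideanSpace ℂ (Fin S) →ₗᵢ[ℂ] H,
      ∀ θ, ‖θ‖ = 1 → ∃ θ', ‖θ'‖ = 1 ∧ ‖θ - θ'‖ ≤ lam / 8 ∧ ∀ ψ, inner ℂ θ' ψ = 0 →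
        ‖(LinearMap.range (Λ (V θ'))).starProjection (V ψ)‖ ^ 2 ≤ lam / 4 * ‖ψ‖ ^ 2 := by
  obtain ⟨q, hq24, hq, hqN, haa, hN⟩ := exists_parameter_bound hlam hlam' hS1 hS ha
  obtain ⟨T, hT1, hT, hTcard⟩ := exists_finset_net_sphere (E := EuclideanSpace ℂ (Fin S))
    (ε := lam / 200) (by positivity)
  have hfr : finrank ℝ (EuclideanSpace ℂ (Fin S)) = 2 * S := by
    rw [finrank_real_of_complex, finrank_euclideanSpace_fin]
  rw [hfr] at hTcard
  rw [← hH] at hqN haa hN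
  rw [← hF] at haa
  have hsmall := union_bound_lt_one hlam' hq24 (Nat.cast_nonneg _) (hTcard.trans hq) hqN haa
  have hN' : (0 : ℝ) < finrank ℂ H := by exact_mod_cast hN
  obtain ⟨G, hG1, hG2⟩ := exists_map_of_net Λ T hT1
    (t := lam * finrank ℂ H / 20) (by positivity) hsmall
  exact exists_linearIsometry_of_net Λ hΛ G hlam hlam' hN' T hT1 hT hG1 hG2

end Final
end QuantumID

theorem mainTheorem2 (lam : ℝ) (hlam_pos : 0 < lam) (hlam_lt : lam < 1) (d S : ℕ)
    (hS : S = ⌊(d : ℝ) ^ 2 * ((lam / 100) ^ 4 / (4 * Real.logb 2 (100 / lam)))⌋₊) :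
    ∃ C : QuantumID.QuantumIDCode (Fin S) (Fin d) lam,
      (∃ (a : ℕ) (V : Matrix (Fin d × Fin a) (Fin S) ℂ), Vᴴ * V = 1 ∧
        ∀ X, C.encoder.toCP X = QuantumID.partialTraceRight (V * X * Vᴴ)) ∧
      ∀ τ : QuantumID.PureState (Fin S), ∃ τ' : QuantumID.PureState (Fin S),
        QuantumID.IsSupportProjector (C.decoder τ) (C.encoder.toCP τ'.density) := by
  open QuantumID in
  obtain ⟨a, V, hV⟩ : ∃ (a : ℕ)
      (V : EuclideanSpace ℂ (Fin S) →ₗᵢ[ℂ] EuclideanSpace ℂ (Fin d × Fin a)),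
      ∀ θ, ‖θ‖ = 1 → ∃ θ', ‖θ'‖ = 1 ∧ ‖θ - θ'‖ ≤ lam / 8 ∧ ∀ ψ, inner ℂ θ' ψ = 0 →
        ‖(LinearMap.range (columnAction (V θ'))).starProjection (V ψ)‖ ^ 2 ≤
          lam / 4 * ‖ψ‖ ^ 2 := by
    rcases Nat.eq_zero_or_pos S with h0 | h0
    -- Without messages there are no unit vectors, and the zero map is an isometry.
    · subst h0
      refine ⟨0, ⟨0, fun x => by rw [Subsingleton.elim x 0]; simp⟩, fun θ hθ => ?_⟩
      rw [Subsingleton.elim θ 0] at hθ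
      simp at hθ
    · obtain ⟨a, ha⟩ : ∃ a, a = ⌊lam * d / 300⌋₊ := ⟨_, rfl⟩
      have hS' : (S : ℝ) ≤ (d : ℝ) ^ 2 * ((lam / 100) ^ 4 / (4 * Real.logb 2 (100 / lam))) := by
        rw [hS]
        refine Nat.floor_le (mul_nonneg (sq_nonneg _) (div_nonneg (by positivity)
          (mul_nonneg (by norm_num) (Real.logb_nonneg (by norm_num) ?_))))
        rw [le_div_iff₀ hlam_pos]
        linarith
      have h := exists_linearIsometry_code (H := EuclideanSpace ℂ (Fin d × Fin a))
        (F := Fin a → Fin a → ℂ) columnAction mem_range_columnAction hlam_pos hlam_lt h0 hS' ha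
        (by simp [finrank_euclideanSpace]) (by simp [Module.finrank_pi_fintype])
      exact ⟨a, h⟩
  set W : Matrix (Fin d × Fin a) (Fin S) ℂ := Matrix.toEuclideanLin.symm V.toLinearMap with hW
  have hWW : Wᴴ * W = 1 := by
    ext i j
    have h := V.inner_map_map (EuclideanSpace.single i 1) (EuclideanSpace.single j 1)
    have hcol : ∀ (j : Fin S) p, W p j = V (EuclideanSpace.single j 1) p := fun j p => by
      have : W *ᵥ (EuclideanSpace.single j (1 : ℂ)).ofLp =
          (V (EuclideanSpace.single j 1)).ofLp := toEuclideanLin_symm_mulVec V.toLinearMap _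
      rw [← this]
      simp
    rw [Matrix.mul_apply, Matrix.one_apply]
    rw [PiLp.inner_apply] at h
    simp only [Matrix.conjTranspose_apply, hcol]
    refine (Finset.sum_congr rfl fun p _ => mul_comm _ _).trans (h.trans ?_)
    rw [EuclideanSpace.inner_single_left]
    simp
  have key : ∀ τ : PureState (Fin S), ∃ (D : Matrix (Fin d) (Fin d) ℂ) (τ' : PureState (Fin S)),
      IsSupportProjector D ((isometryChannel W hWW).toCP τ'.density) ∧
      ∀ π : PureState (Fin S), ‖(π.density * τ.density).trace -
        ((isometryChannel W hWW).toCP π.density * D).trace‖ ≤ lam / 2 := by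
    rintro ⟨_, θ, hθ, rfl⟩
    obtain ⟨θ', hθ', hdist, hsmall⟩ := hV θ hθ
    obtain ⟨D, hD⟩ := exists_isSupportProjector (toMat (V θ') * (toMat (V θ'))ᴴ)
    refine ⟨D, ⟨_, θ', hθ', rfl⟩, ?_, ?_⟩
    · rw [isometryChannel_toCP_apply]
      exact (partialTraceRight_conj_pure V.toLinearMap θ').symm ▸ hD
    · rintro ⟨_, φ, hφ, rfl⟩
      rw [isometryChannel_toCP_apply]
      simp only [PureState.density]
      rw [hW, partialTraceRight_conj_pure V.toLinearMap φ, trace_mul_pure]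
      erw [trace_mul_supportProjector hD (V φ)]
      rw [← Complex.ofReal_sub, Complex.norm_real]
      exact abs_overlap_sub_le V _ hlam_pos.le hφ hθ hθ' (mem_range_columnAction _) hdist hsmall
  choose D τ' hD herr using key
  exact ⟨⟨isometryChannel W hWW, D, fun τ => (hD τ).1.nonneg, fun τ => (hD τ).1.le_one,
    fun π τ => herr τ π⟩, ⟨a, W, hWW, fun X => rfl⟩, fun τ => ⟨τ' τ, hD τ⟩⟩
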